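/- All topological groups are Hausdorff; "t.d.l.c." means totally disconnected locally compact. A topological group is *topologically simple* if it is non-trivial and its only closed normal subgroups are $\{1\}$ and itself. The *quasi-center* $\mathrm{QZ}(G)$ is the set of elements of $G$ with open centralizer. A t.d.l.c. group $G$ is *regionally expansive* if some compactly generated open subgroup $O\le G$ has a compact open subgroup $W\le O$ with $\bigcap_{g\in O}gWg^{-1}=\{1\}$. The *monolith* $\mathrm{Mon}(G)$ is the intersection of all non-trivial closed normal subgroups of $G$; $G$ is *monolithic* if $\mathrm{Mon}(G)\neq\{1\}$. The class $\mathscr R$ of *robustly monolithic* groups consists of the monolithic t.d.l.c. groups whose monolith is non-discrete, regionally expansive and topologically simple. A *local isomorphism* from $G$ to $H$ is an isomorphism of topological groups from an open subgroup of $G$ to an open subgroup of $H$; $G$ and $H$ are *locally isomorphic* if one exists. Two local isomorphisms have the same *germ* if they agree on some open subgroup contained in both domains. For a t.d.l.c. group $G$ with $\mathrm{QZ}(G)=\{1\}$, the group $\mathscr L(G)$ of *germs of automorphisms* of $G$ is the set of germs of local isomorphisms from $G$ to itself, with the group law induced by composition and the unique group topology for which the homomorphism $\mathrm{ad}\colon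 G\to\mathscr L(G)$, $g\mapsto[y\mapsto gyg^{-1}]$, is continuous and open. An *open embedding* is an injective, continuous and open homomorphism. **Corollary.** Let $G$ be a topologically simple t.d.l.c. group with $\mathrm{QZ}(G)=\{1\}$. Then there is a topologically simple t.d.l.c. group $\widetilde G$ with $\mathrm{QZ}(\widetilde G)=\{1\}$, unique up to isomorphism of topological groups, such that: (i) $G$ embeds as an open subgroup of $\widetilde G$; (ii) every topologically simple t.d.l.c. group locally isomorphic to $G$ admits an open embedding into $\widetilde G$. If moreover $G$ is regionally expansive, then $G$, $\widetilde G$ and $\mathscr L(G)$ all belong to $\mathscr R$, and $\mathscr L(G)$ is, up to isomorphism of topological groups, the unique t.d.l.c. group $L$ with an open monolith $M=\mathrm{Mon}(L)\neq\{1\}$ such that: (a) $G$ embeds as an open subgroup of $M$; (b) for every t.d.l.c. group $H$ locally isomorphic to $G$ there is a continuous open homomorphism $\theta\colon H\to L$, with $\theta(H)\le M$ if $H$ is topologically simple; (c) $M$ and $L$ both belong to $\mathscr R$. Furthermore, $\widetilde G$ is isomorphic, as a topological group, to the monolith of $\mathscr L(G)$. -/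

import Mathlib

open Topology

universe u v w

/-- A totally disconnected locally compact (Hausdorff) topological group. -/
class IsTDLCGroup (G : Type u) [Group G] [TopologicalSpace G] : Prop extends
  IsTopologicalGroup G, T2Space G, LocallyCompactSpace G, TotallyDisconnectedSpace G

/-- `G` is topologically simple: it is non-trivial, and its only closed normal subgroups are
`1` and `G`. -/
def TopologicallySimple (G : Type u) [Group G] [TopologicalSpace G] : Prop :=
  Nontrivial G ∧ ∀ N : Subgroup G, N.Normal → IsClosed (N : Set G) → N = ⊥ ∨ N = ⊤

/-- The quasi-center: the set of elements with open centralizer. -/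
def quasiCenter (G : Type u) [Group G] [TopologicalSpace G] : Set G :=
  {g | IsOpen (Subgroup.centralizer {g} : Set G)}

/-- `G` is generated, as an abstract group, by a compact subset. -/
def IsCompactlyGeneratedGroup (G : Type u) [Group G] [TopologicalSpace G] : Prop :=
  ∃ K : Set G, IsCompact K ∧ Subgroup.closure K = ⊤

/-- Some compactly generated open subgroup `O` of `G` has a compact open subgroup `W` whose normal
core in `O` is trivial. -/
def RegionallyExpansive (G : Type u) [Group G] [TopologicalSpace G] : Prop :=
  ∃ O : Subgroup G, IsOpen (O : Set G) ∧ IsCompactlyGeneratedGroup O ∧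
    ∃ W : Subgroup O, IsCompact (W : Set O) ∧ IsOpen (W : Set O) ∧ W.normalCore = ⊥

/-- The intersection of all non-trivial closed normal subgroups of `G`. -/
def monolith (G : Type u) [Group G] [TopologicalSpace G] : Subgroup G :=
  sInf {N : Subgroup G | N.Normal ∧ IsClosed (N : Set G) ∧ N ≠ ⊥}

/-- `G` is monolithic: the intersection of all non-trivial closed normal subgroups is
non-trivial. -/
def IsMonolithic (G : Type u) [Group G] [TopologicalSpace G] : Prop :=
  monolith G ≠ ⊥

/-- Membership in the class `R`: a t.d.l.c. group that is monolithic and whose monolith is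
non-discrete, regionally expansive and topologically simple. -/
structure RobustlyMonolithic (G : Type u) [Group G] [TopologicalSpace G] : Prop where
  tdlc : IsTDLCGroup G
  monolithic : IsMonolithic G
  nondiscrete : ¬ DiscreteTopology (monolith G)
  regionallyExpansive : RegionallyExpansive (monolith G)
  simple : TopologicallySimple (monolith G)

/-- A local isomorphism from `G` to `H`: an isomorphism of topological groups from an open subgroup
of `G` to an open subgroup of `H`. -/
structure LocalIso (G : Type u) (H : Type v) [Group G] [TopologicalSpace G]
    [Group H] [TopologicalSpace H] where
  source : Subgroup G
  isOpen_source : IsOpen (source : Set G)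
  toHom : source →* H
  isOpenEmbedding : IsOpenEmbedding toHom

/-- `G` and `H` are locally isomorphic. -/
def LocallyIsomorphic (G : Type u) (H : Type v) [Group G] [TopologicalSpace G]
    [Group H] [TopologicalSpace H] : Prop :=
  Nonempty (LocalIso G H)

namespace LocalIso

section basic

variable {G : Type u} {H : Type v} {K : Type w} [Group G] [TopologicalSpace G]
  [Group H] [TopologicalSpace H] [Group K] [TopologicalSpace K]

/-- Two local isomorphisms are equivalent if they agree on an open subgroup contained in both
domains. -/
def Equivalent (φ ψ : LocalIso G H) : Prop :=
  ∃ W : Subgroup G, IsOpen (W : Set G) ∧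
    ∃ (hφ : W ≤ φ.source) (hψ : W ≤ ψ.source),
      ∀ (g : G) (hg : g ∈ W), φ.toHom ⟨g, hφ hg⟩ = ψ.toHom ⟨g, hψ hg⟩

theorem Equivalent.refl (φ : LocalIso G H) : Equivalent φ φ :=
  ⟨φ.source, φ.isOpen_source, le_rfl, le_rfl, fun _ _ => rfl⟩

theorem Equivalent.symm {φ ψ : LocalIso G H} : Equivalent φ ψ → Equivalent ψ φ := by
  rintro ⟨W, hW, h1, h2, h⟩
  exact ⟨W, hW, h2, h1, fun g hg => (h g hg).symm⟩

theorem Equivalent.trans {φ ψ χ : LocalIso G H} :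
    Equivalent φ ψ → Equivalent ψ χ → Equivalent φ χ := by
  rintro ⟨W, hW, h1, h2, h⟩ ⟨W', hW', h1', h2', h'⟩
  exact ⟨W ⊓ W', hW.inter hW', fun g hg => h1 hg.1, fun g hg => h2' hg.2,
    fun g hg => (h g hg.1).trans (h' g hg.2)⟩

instance setoid (G : Type u) (H : Type v) [Group G] [TopologicalSpace G]
    [Group H] [TopologicalSpace H] : Setoid (LocalIso G H) where
  r := Equivalent
  iseqv := ⟨Equivalent.refl, Equivalent.symm, Equivalent.trans⟩

/-- The identity map of `G`. -/
def id (G : Type u) [Group G] [TopologicalSpace G] : LocalIso G G where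
  source := ⊤
  isOpen_source := isOpen_univ
  toHom := (⊤ : Subgroup G).subtype
  isOpenEmbedding := IsOpen.isOpenEmbedding_subtypeVal isOpen_univ

/-- The composite of `φ` followed by `ψ`, defined on the elements of the domain of `φ` that `φ` maps
into the domain of `ψ`. -/
def comp (ψ : LocalIso H K) (φ : LocalIso G H) : LocalIso G K where
  source :=
    { carrier := {g | ∃ hg : g ∈ φ.source, φ.toHom ⟨g, hg⟩ ∈ ψ.source}
      one_mem' := ⟨one_mem _, by
        have : φ.toHom ⟨1, one_mem _⟩ = 1 := map_one φ.toHom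
        rw [this]; exact one_mem _⟩
      mul_mem' := by
        rintro a b ⟨ha, ha'⟩ ⟨hb, hb'⟩
        refine ⟨mul_mem ha hb, ?_⟩
        have : φ.toHom ⟨a * b, mul_mem ha hb⟩ = φ.toHom ⟨a, ha⟩ * φ.toHom ⟨b, hb⟩ :=
          map_mul φ.toHom ⟨a, ha⟩ ⟨b, hb⟩
        rw [this]; exact mul_mem ha' hb'
      inv_mem' := by
        rintro a ⟨ha, ha'⟩
        refine ⟨inv_mem ha, ?_⟩
        have : φ.toHom ⟨a⁻¹, inv_mem ha⟩ = (φ.toHom ⟨a, ha⟩)⁻¹ := map_inv φ.toHom ⟨a, ha⟩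
        rw [this]; exact inv_mem ha' }
  isOpen_source := by
    have h := φ.isOpen_source.isOpenMap_subtype_val _
      (ψ.isOpen_source.preimage φ.isOpenEmbedding.continuous)
    convert h using 1
    ext g
    constructor
    · rintro ⟨hg, hg'⟩
      exact ⟨⟨g, hg⟩, hg', rfl⟩
    · rintro ⟨⟨g, hg⟩, hg', rfl⟩
      exact ⟨hg, hg'⟩
  toHom :=
    { toFun := fun g => ψ.toHom ⟨φ.toHom ⟨g.1, g.2.1⟩, g.2.2⟩
      map_one' := by
        have h : φ.toHom ⟨1, one_mem _⟩ = 1 := map_one φ.toHom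
        have h' : ψ.toHom ⟨1, one_mem _⟩ = 1 := map_one ψ.toHom
        simp only [OneMemClass.coe_one, h, h']
      map_mul' := by
        rintro ⟨a, ha, ha'⟩ ⟨b, hb, hb'⟩
        rw [← map_mul]
        congr 1
        exact Subtype.ext (map_mul φ.toHom ⟨a, ha⟩ ⟨b, hb⟩) }
  isOpenEmbedding := by
    refine ψ.isOpenEmbedding.comp ?_
    refine IsOpenEmbedding.of_comp (g := Subtype.val) _
      (ψ.isOpen_source.isOpenEmbedding_subtypeVal) ?_
    refine φ.isOpenEmbedding.comp ?_
    refine IsOpenEmbedding.of_comp (g := Subtype.val) _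
      (φ.isOpen_source.isOpenEmbedding_subtypeVal) ?_
    refine IsOpen.isOpenEmbedding_subtypeVal ?_
    have h := φ.isOpen_source.isOpenMap_subtype_val _
      (ψ.isOpen_source.preimage φ.isOpenEmbedding.continuous)
    convert h using 1
    ext g
    constructor
    · rintro ⟨hg, hg'⟩
      exact ⟨⟨g, hg⟩, hg', rfl⟩
    · rintro ⟨⟨g, hg⟩, hg', rfl⟩
      exact ⟨hg, hg'⟩

/-- The inverse map, defined on the image. -/
noncomputable def inv (φ : LocalIso G H) : LocalIso H G where
  source := φ.toHom.range
  isOpen_source := by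
    rw [MonoidHom.coe_range]
    exact φ.isOpenEmbedding.isOpen_range
  toHom := φ.source.subtype.comp
    (MonoidHom.ofInjective φ.isOpenEmbedding.injective).symm.toMonoidHom
  isOpenEmbedding := by
    refine φ.isOpen_source.isOpenEmbedding_subtypeVal.comp ?_
    have h : ∀ y, φ.toHom ((MonoidHom.ofInjective φ.isOpenEmbedding.injective).symm y) = y :=
      fun y => congrArg Subtype.val
        ((MonoidHom.ofInjective φ.isOpenEmbedding.injective).apply_symm_apply y)
    refine IsOpenEmbedding.of_comp _ φ.isOpenEmbedding ?_
    have h' : (φ.toHom ∘ (MonoidHom.ofInjective φ.isOpenEmbedding.injective).symm)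
        = Subtype.val := funext h
    change IsOpenEmbedding
      (φ.toHom ∘ (MonoidHom.ofInjective φ.isOpenEmbedding.injective).symm)
    rw [h']
    refine IsOpen.isOpenEmbedding_subtypeVal ?_
    rw [MonoidHom.coe_range]
    exact φ.isOpenEmbedding.isOpen_range

theorem inv_toHom (φ : LocalIso G H) (g : φ.source) (h : φ.toHom g ∈ φ.inv.source) :
    φ.inv.toHom ⟨φ.toHom g, h⟩ = g := by
  have : (MonoidHom.ofInjective φ.isOpenEmbedding.injective) g = ⟨φ.toHom g, h⟩ := rfl
  change (((MonoidHom.ofInjective φ.isOpenEmbedding.injective).symm ⟨φ.toHom g, h⟩ :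
    φ.source) : G) = g
  rw [← this, MulEquiv.symm_apply_apply]

theorem Equivalent.comp {ψ ψ' : LocalIso H K} {φ φ' : LocalIso G H}
    (hψ : Equivalent ψ ψ') (hφ : Equivalent φ φ') :
    Equivalent (ψ.comp φ) (ψ'.comp φ') := by
  obtain ⟨W, hW, h1, h2, h⟩ := hφ
  obtain ⟨W', hW', h1', h2', h'⟩ := hψ
  let ρ : LocalIso G H :=
    { source := W
      isOpen_source := hW
      toHom := φ.toHom.comp (Subgroup.inclusion h1)
      isOpenEmbedding := by
        refine φ.isOpenEmbedding.comp ?_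
        exact IsOpenEmbedding.of_comp (g := Subtype.val) _
          (φ.isOpen_source.isOpenEmbedding_subtypeVal) (hW.isOpenEmbedding_subtypeVal) }
  let σ : LocalIso H H :=
    { source := W'
      isOpen_source := hW'
      toHom := W'.subtype
      isOpenEmbedding := hW'.isOpenEmbedding_subtypeVal }
  refine ⟨(σ.comp ρ).source, (σ.comp ρ).isOpen_source, ?_, ?_, ?_⟩
  · rintro g ⟨hg, hg'⟩
    exact ⟨h1 hg, h1' hg'⟩
  · rintro g ⟨hg, hg'⟩
    refine ⟨h2 hg, h2' ?_⟩
    rw [← h g hg]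
    exact hg'
  · rintro g ⟨hg, hg'⟩
    have e : φ.toHom ⟨g, h1 hg⟩ = φ'.toHom ⟨g, h2 hg⟩ := h g hg
    have e' := h' (φ.toHom ⟨g, h1 hg⟩) hg'
    change ψ.toHom ⟨φ.toHom ⟨g, h1 hg⟩, _⟩ = ψ'.toHom ⟨φ'.toHom ⟨g, h2 hg⟩, _⟩
    rw [e']
    congr 1
    exact Subtype.ext e

theorem Equivalent.inv {φ ψ : LocalIso G H} (hφ : Equivalent φ ψ) :
    Equivalent φ.inv ψ.inv := by
  obtain ⟨W, hW, h1, h2, h⟩ := hφ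
  have hi : IsOpenEmbedding (Subgroup.inclusion h1) :=
    IsOpenEmbedding.of_comp (g := Subtype.val) _
      (φ.isOpen_source.isOpenEmbedding_subtypeVal) (hW.isOpenEmbedding_subtypeVal)
  refine ⟨(φ.toHom.comp (Subgroup.inclusion h1)).range, ?_, ?_, ?_, ?_⟩
  · rw [MonoidHom.coe_range]
    exact (φ.isOpenEmbedding.comp hi).isOpen_range
  · rintro _ ⟨g, rfl⟩
    exact ⟨_, rfl⟩
  · rintro _ ⟨g, rfl⟩
    exact ⟨⟨g.1, h2 g.2⟩, (h g.1 g.2).symm⟩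
  · rintro _ ⟨g, rfl⟩
    have e := φ.inv_toHom ⟨g.1, h1 g.2⟩ ⟨_, rfl⟩
    have e' := ψ.inv_toHom ⟨g.1, h2 g.2⟩ ⟨_, rfl⟩
    refine e.trans (e'.symm.trans ?_)
    congr 1
    exact Subtype.ext (h g.1 g.2).symm

end basic

/-- Conjugation by `g`, as a local isomorphism from `G` to itself. -/
def conj {G : Type u} [Group G] [TopologicalSpace G] [IsTopologicalGroup G] (g : G) :
    LocalIso G G where
  source := ⊤
  isOpen_source := isOpen_univ
  toHom := (MulAut.conj g).toMonoidHom.comp (⊤ : Subgroup G).subtype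
  isOpenEmbedding :=
    ((Homeomorph.mulLeft g).trans (Homeomorph.mulRight g⁻¹)).isOpenEmbedding.comp
      (IsOpen.isOpenEmbedding_subtypeVal isOpen_univ)

end LocalIso

/-- The set of germs of local isomorphisms from `G` to itself. -/
def GermGroup (G : Type u) [Group G] [TopologicalSpace G] : Type u :=
  Quotient (LocalIso.setoid G G)

namespace GermGroup

variable {G : Type u} [Group G] [TopologicalSpace G]

/-- The germ of a local isomorphism from `G` to itself. -/
def mk (φ : LocalIso G G) : GermGroup G := Quotient.mk (LocalIso.setoid G G) φ

theorem mk_eq_mk {φ ψ : LocalIso G G} : mk φ = mk ψ ↔ LocalIso.Equivalent φ ψ :=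
  Quotient.eq (r := LocalIso.setoid G G)

/-- The product of two germs is the germ of the composite. -/
instance : Mul (GermGroup G) :=
  ⟨Quotient.map₂ LocalIso.comp (fun _ _ h _ _ h' => LocalIso.Equivalent.comp h h')⟩

noncomputable instance : Inv (GermGroup G) :=
  ⟨Quotient.map LocalIso.inv (fun _ _ h => LocalIso.Equivalent.inv h)⟩

instance : One (GermGroup G) := ⟨mk (LocalIso.id G)⟩

theorem mk_mul_mk (φ ψ : LocalIso G G) : mk φ * mk ψ = mk (φ.comp ψ) := rfl

theorem inv_mk (φ : LocalIso G G) : (mk φ)⁻¹ = mk φ.inv := rfl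

theorem one_eq_mk : (1 : GermGroup G) = mk (LocalIso.id G) := rfl

theorem exists_mk (a : GermGroup G) : ∃ φ, mk φ = a := Quotient.exists_rep a

/-- The group `ℒ(G)`: germs form a group under composition. -/
noncomputable instance : Group (GermGroup G) :=
  Group.ofLeftAxioms
    (by
      intro a b c
      obtain ⟨φ, rfl⟩ := exists_mk a
      obtain ⟨ψ, rfl⟩ := exists_mk b
      obtain ⟨χ, rfl⟩ := exists_mk c
      refine mk_eq_mk.2 ⟨((φ.comp ψ).comp χ).source, ((φ.comp ψ).comp χ).isOpen_source,
        le_rfl, ?_, fun g hg => rfl⟩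
      rintro g ⟨h1, h2, h3⟩
      exact ⟨⟨h1, h2⟩, h3⟩)
    (by
      intro a
      obtain ⟨φ, rfl⟩ := exists_mk a
      exact mk_eq_mk.2 ⟨φ.source, φ.isOpen_source, fun g hg => ⟨hg, trivial⟩, le_rfl,
        fun g hg => rfl⟩)
    (by
      intro a
      obtain ⟨φ, rfl⟩ := exists_mk a
      exact mk_eq_mk.2 ⟨φ.source, φ.isOpen_source, fun g hg => ⟨hg, ⟨_, rfl⟩⟩,
        fun g _ => trivial, fun g hg => φ.inv_toHom ⟨g, hg⟩ _⟩)

variable [IsTopologicalGroup G]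

/-- The homomorphism sending `g` to the germ of `y ↦ g * y * g⁻¹`. -/
def ad (G : Type u) [Group G] [TopologicalSpace G] [IsTopologicalGroup G] :
    G →* GermGroup G where
  toFun g := mk (LocalIso.conj g)
  map_one' := mk_eq_mk.2 ⟨⊤, isOpen_univ, le_rfl, le_rfl, fun g _ => by
    change 1 * g * 1⁻¹ = g
    group⟩
  map_mul' a b := mk_eq_mk.2 ⟨⊤, isOpen_univ, le_rfl, fun g _ => ⟨trivial, trivial⟩, fun g _ => by
    change (a * b) * g * (a * b)⁻¹ = a * (b * g * b⁻¹) * a⁻¹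
    group⟩

theorem mk_mul_ad_mul_inv (φ : LocalIso G G) (g : φ.source) :
    mk φ * ad G g * (mk φ)⁻¹ = ad G (φ.toHom g) := by
  rw [mul_inv_eq_iff_eq_mul]
  refine mk_eq_mk.2 ⟨φ.source, φ.isOpen_source, ?_, fun x hx => ⟨hx, trivial⟩, ?_⟩
  · intro x hx
    exact ⟨trivial, mul_mem (mul_mem g.2 hx) (inv_mem g.2)⟩
  · intro x hx
    have h : φ.toHom (g * ⟨x, hx⟩ * g⁻¹) =
        φ.toHom g * φ.toHom ⟨x, hx⟩ * (φ.toHom g)⁻¹ := by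
      rw [map_mul, map_mul, map_inv]
    exact h

/-- The images under `ad` of the identity neighbourhoods of `G` are a basis of identity
neighbourhoods of a group topology on the group of germs. -/
noncomputable abbrev filterBasis (G : Type u) [Group G] [TopologicalSpace G] [IsTopologicalGroup G] :
    GroupFilterBasis (GermGroup G) where
  sets := {S | ∃ V ∈ 𝓝 (1 : G), S = ad G '' V}
  nonempty := ⟨_, Set.univ, Filter.univ_mem, rfl⟩
  inter_sets := by
    rintro _ _ ⟨V, hV, rfl⟩ ⟨V', hV', rfl⟩
    exact ⟨_, ⟨V ∩ V', Filter.inter_mem hV hV', rfl⟩, Set.image_inter_subset _ _ _⟩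
  one' := by
    rintro _ ⟨V, hV, rfl⟩
    exact ⟨1, mem_of_mem_nhds hV, map_one _⟩
  mul' := by
    rintro _ ⟨V, hV, rfl⟩
    obtain ⟨V', hV', h1, h⟩ := exists_open_nhds_one_mul_subset hV
    refine ⟨_, ⟨V', hV'.mem_nhds h1, rfl⟩, ?_⟩
    rw [← Set.image_mul]
    exact Set.image_mono h
  inv' := by
    rintro _ ⟨V, hV, rfl⟩
    refine ⟨_, ⟨V⁻¹, inv_mem_nhds_one G hV, rfl⟩, ?_⟩
    rintro _ ⟨g, hg, rfl⟩
    exact ⟨g⁻¹, hg, map_inv _ _⟩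
  conj' := by
    rintro a _ ⟨V, hV, rfl⟩
    obtain ⟨φ, rfl⟩ := exists_mk a
    refine ⟨_, ⟨Subtype.val '' (φ.toHom ⁻¹' V), ?_, rfl⟩, ?_⟩
    · refine φ.isOpen_source.isOpenMap_subtype_val.image_mem_nhds (x := (1 : φ.source)) ?_
      refine φ.isOpenEmbedding.continuous.continuousAt.preimage_mem_nhds ?_
      rwa [map_one]
    · rintro _ ⟨_, ⟨g, hg, rfl⟩, rfl⟩
      exact ⟨φ.toHom g, hg, (mk_mul_ad_mul_inv φ g).symm⟩

/-- The topology of `ℒ(G)`: the group topology for which `ad` is continuous and open. -/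
noncomputable instance : TopologicalSpace (GermGroup G) := (filterBasis G).topology

instance : IsTopologicalGroup (GermGroup G) := (filterBasis G).isTopologicalGroup

theorem nhds_one_eq : 𝓝 (1 : GermGroup G) = Filter.map (ad G) (𝓝 1) := by
  ext S
  rw [(filterBasis G).nhds_one_hasBasis.mem_iff]
  constructor
  · rintro ⟨_, ⟨V, hV, rfl⟩, h⟩
    exact Filter.mem_of_superset (x := V) hV fun g hg => h ⟨g, hg, rfl⟩
  · intro h
    exact ⟨_, ⟨_, h, rfl⟩, Set.image_preimage_subset _ _⟩

theorem continuous_ad : Continuous (ad G) :=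
  continuous_of_continuousAt_one _ (by
    rw [ContinuousAt, map_one, nhds_one_eq]
    exact Filter.tendsto_map)

theorem isOpenMap_ad : IsOpenMap (ad G) :=
  IsTopologicalGroup.isOpenMap_iff_nhds_one.2 nhds_one_eq.le

/-- The topology is the only group topology for which `ad` is continuous and open. -/
theorem topology_unique (t : TopologicalSpace (GermGroup G))
    (ht : @IsTopologicalGroup (GermGroup G) t _)
    (hc : @Continuous _ _ _ t (ad G)) (ho : @IsOpenMap _ _ _ t (ad G)) :
    t = instTopologicalSpace := by
  refine IsTopologicalGroup.ext ht inferInstance ?_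
  rw [nhds_one_eq]
  apply le_antisymm
  · have h := @IsOpenMap.nhds_le _ _ _ _ t ho 1
    rwa [map_one] at h
  · have h := @Continuous.tendsto _ _ _ t (ad G) hc 1
    rwa [map_one] at h

end GermGroup

/-- `T` is a largest topologically simple group in the local isomorphism class of `G`: it is a
topologically simple t.d.l.c. group with trivial quasi-center that contains `G` as an open
subgroup, and every topologically simple t.d.l.c. group that is locally isomorphic to `G` admits an
open embedding into `T`. -/
structure IsLargestSimple (G : Type u) [Group G] [TopologicalSpace G]
    (T : Type u) [Group T] [TopologicalSpace T] : Prop where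
  tdlc : IsTDLCGroup T
  simple : TopologicallySimple T
  quasiCenter_eq : quasiCenter T = {1}
  exists_embedding : ∃ j : G →* T, IsOpenEmbedding j
  universal : ∀ (H : Type u) [Group H] [TopologicalSpace H] [IsTDLCGroup H],
    TopologicallySimple H → LocallyIsomorphic H G → ∃ i : H →* T, IsOpenEmbedding i

/-- `L` is a t.d.l.c. group with an open monolith such that: `G` embeds as an open subgroup of the
monolith; every t.d.l.c. group `H` locally isomorphic to `G` has a continuous open homomorphism to
`L`, with image in the monolith if `H` is topologically simple; and both `L` and its monolith are
robustly monolithic. -/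
structure IsUniversalLocalGroup (G : Type u) [Group G] [TopologicalSpace G]
    (L : Type u) [Group L] [TopologicalSpace L] : Prop where
  tdlc : IsTDLCGroup L
  monolithic : IsMonolithic L
  isOpen_monolith : IsOpen (monolith L : Set L)
  exists_embedding : ∃ j : G →* monolith L, IsOpenEmbedding j
  universal : ∀ (H : Type u) [Group H] [TopologicalSpace H] [IsTDLCGroup H],
    LocallyIsomorphic H G → ∃ θ : H →* L, Continuous θ ∧ IsOpenMap θ ∧
      (TopologicallySimple H → θ.range ≤ monolith L)
  robustlyMonolithic_monolith : RobustlyMonolithic (monolith L)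
  robustlyMonolithic : RobustlyMonolithic L

/-!
Write `ℒ` for the group of germs `GermGroup G`. Since the quasi-center of `G` is trivial,
`ad : G → ℒ` is an open embedding and the quasi-center of `ℒ` is trivial as well. Two facts about
`ℒ` carry the argument.

* A local isomorphism `φ` from `H` to `G` induces a continuous open homomorphism
  `LocalIso.germHom φ : H → ℒ`, sending `h` to the germ of `φ ∘ conj h ∘ φ⁻¹`. It is injective as
  soon as the monolith of `H` is open, in particular when `H` is topologically simple
  (`injective_of_isOpen_monolith`).
* Every open embedding into `ℒ` of an open subgroup `S ≤ ℒ` is conjugation by an element of `ℒ`,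
  namely by the germ that it induces on `G` (`GermGroup.exists_eq_conj`); hence its image is `S`
  if `S` is normal (`GermGroup.range_eq_of_isOpenEmbedding`).

Let `T` be the subgroup of `ℒ` generated by all topologically simple open subgroups. It is open and
normal. A discrete normal subgroup of a topological group lies in the quasi-center, so a closed
normal subgroup `N` of `T` meeting some topologically simple open subgroup `S` trivially is trivial;
otherwise `N` contains every such `S`, and `N = T`. So `T` is topologically simple
(`topologicallySimple_simpleSup`), and by the same argument it is the monolith of `ℒ`
(`monolith_eq_of_topologicallySimple`). The homomorphisms `germHom` make `T` and `ℒ` universal.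
If `T'` is another largest simple group, the composite of an open embedding `T → T'` and of
`germHom : T' → T` is conjugation by an element of `ℒ`, so that `germHom` is onto `T`; the uniqueness
of `ℒ` is obtained in the same way.
-/

/-! ### Quasi-center, monolith and topological simplicity -/

section TopologicalGroup

variable {H : Type u} {L : Type v} [Group H] [TopologicalSpace H] [Group L] [TopologicalSpace L]

theorem mem_quasiCenter_of_mem_nhds [IsTopologicalGroup L] {x : L} {U : Set L} (hU : U ∈ 𝓝 1)
    (h : ∀ u ∈ U, u * x = x * u) : x ∈ quasiCenter L :=
  Subgroup.isOpen_of_mem_nhds _ (g := 1) (Filter.mem_of_superset hU fun u hu =>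
    Subgroup.mem_centralizer_singleton_iff.2 (h u hu))

theorem quasiCenter_eq_singleton [IsTopologicalGroup L] (h : ∀ x ∈ quasiCenter L, x = 1) :
    quasiCenter L = {1} :=
  Set.eq_singleton_iff_unique_mem.2
    ⟨mem_quasiCenter_of_mem_nhds Filter.univ_mem fun u _ => by simp, h⟩

theorem quasiCenter_eq_of_isOpenEmbedding [IsTopologicalGroup H] [IsTopologicalGroup L] (f : H →* L)
    (hf : IsOpenEmbedding f) (hL : quasiCenter L = {1}) : quasiCenter H = {1} := by
  refine quasiCenter_eq_singleton fun x hx => hf.injective ?_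
  have hmem : f x ∈ quasiCenter L := by
    have hU : f '' (Subgroup.centralizer {x} : Set H) ∈ 𝓝 1 :=
      (hf.isOpenMap _ hx).mem_nhds ⟨1, one_mem _, map_one f⟩
    refine mem_quasiCenter_of_mem_nhds hU ?_
    rintro _ ⟨u, hu, rfl⟩
    rw [← map_mul, ← map_mul, Subgroup.mem_centralizer_singleton_iff.1 hu]
  rw [hL] at hmem
  rw [map_one]
  exact hmem

/-- A normal subgroup that meets an open subgroup trivially is discrete, hence lies in the
quasi-center: the conjugation orbits of its elements are locally constant. -/
theorem subset_quasiCenter_of_disjoint [IsTopologicalGroup L] {N S : Subgroup L} (hN : N.Normal)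
    (hS : IsOpen (S : Set L)) (hd : Disjoint N S) : (N : Set L) ⊆ quasiCenter L := by
  intro n hn
  have hc : Continuous fun s : L => s * n * s⁻¹ * n⁻¹ := by fun_prop
  have hU : (fun s : L => s * n * s⁻¹ * n⁻¹) ⁻¹' S ∈ 𝓝 (1 : L) :=
    (hS.preimage hc).mem_nhds (by simp [one_mem])
  refine mem_quasiCenter_of_mem_nhds hU fun s hs => ?_
  have h1 := Subgroup.disjoint_def.1 hd (mul_mem (hN.conj_mem n hn s) (inv_mem hn)) hs
  rwa [mul_inv_eq_one, mul_inv_eq_iff_eq_mul] at h1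

/-- Homomorphisms into a group with trivial quasi-center are determined by their germs at `1`, as
soon as one of them is open. -/
theorem MonoidHom.eq_of_eventuallyEq_one [IsTopologicalGroup H] [IsTopologicalGroup L]
    (hL : quasiCenter L = {1}) {f f' : H →* L} (hf : IsOpenMap f) (h : ∀ᶠ u in 𝓝 1, f u = f' u) :
    f = f' := by
  ext t
  have hc : Filter.Tendsto (fun u : H => t * u * t⁻¹) (𝓝 1) (𝓝 1) := by
    have : Continuous fun u : H => t * u * t⁻¹ := by fun_prop
    simpa using this.tendsto 1
  have hU := hf.image_mem_nhds (h.and (hc.eventually h))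
  rw [map_one] at hU
  have hmem : (f' t)⁻¹ * f t ∈ quasiCenter L := by
    refine mem_quasiCenter_of_mem_nhds hU ?_
    rintro _ ⟨u, ⟨h1, h2⟩, rfl⟩
    simp only [map_mul, map_inv, ← h1] at h2
    have h3 : f t * f u = f' t * f u * (f' t)⁻¹ * f t := by rw [← h2]; group
    rw [mul_assoc (f' t)⁻¹, h3]
    group
  rw [hL] at hmem
  exact (inv_mul_eq_one.1 hmem).symm

theorem monolith_le {N : Subgroup H} (hN : N.Normal) (hc : IsClosed (N : Set H)) (h : N ≠ ⊥) :
    monolith H ≤ N :=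
  sInf_le ⟨hN, hc, h⟩

theorem monolith_eq_top_of_topologicallySimple (h : TopologicallySimple H) : monolith H = ⊤ :=
  top_le_iff.1 (le_sInf fun N hN => ((h.2 N hN.1 hN.2.1).resolve_left hN.2.2).ge)

/-- If the kernel were non-trivial it would contain the open monolith, and the open map `f` would make
`{1}` open in `L`. -/
theorem injective_of_isOpen_monolith [IsTopologicalGroup L] [T1Space L]
    (hL : ¬ DiscreteTopology L) (hH : IsOpen (monolith H : Set H)) {f : H →* L}
    (hf : Continuous f) (hfo : IsOpenMap f) : Function.Injective f := by
  rw [← MonoidHom.ker_eq_bot_iff]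
  by_contra hne
  have hle : monolith H ≤ f.ker :=
    monolith_le inferInstance (by
      have : (f.ker : Set H) = f ⁻¹' {1} := rfl
      rw [this]
      exact isClosed_singleton.preimage hf) hne
  refine hL (discreteTopology_of_isOpen_singleton_one ?_)
  have himg : f '' (monolith H : Set H) = {1} :=
    Set.eq_singleton_iff_unique_mem.2
      ⟨⟨1, one_mem _, map_one f⟩, by rintro _ ⟨x, hx, rfl⟩; exact hle hx⟩
  rw [← himg]
  exact hfo _ hH

/-- A normal open topologically simple subgroup of a group with trivial quasi-center is the
monolith. -/
theorem monolith_eq_of_topologicallySimple [IsTopologicalGroup L] (hL : quasiCenter L = {1})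
    {T : Subgroup L} (hn : T.Normal) (ho : IsOpen (T : Set L)) (hT : TopologicallySimple T) :
    monolith L = T := by
  apply le_antisymm
  · refine monolith_le hn (T.isClosed_of_isOpen ho) fun h => ?_
    exact not_subsingleton_iff_nontrivial.2 hT.1 (by rw [h]; infer_instance)
  · refine le_sInf fun N hN => ?_
    obtain ⟨hN, hc, hne⟩ := hN
    rcases hT.2 (N.subgroupOf T) inferInstance (hc.preimage continuous_subtype_val) with h | h
    · refine absurd ?_ hne
      refine (Subgroup.eq_bot_iff_forall _).2 fun x hx => ?_
      have := subset_quasiCenter_of_disjoint hN ho (Subgroup.subgroupOf_eq_bot.1 h) hx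
      rwa [hL] at this
    · exact Subgroup.subgroupOf_eq_top.1 h

theorem TopologicallySimple.of_continuousMulEquiv (e : H ≃ₜ* L) (h : TopologicallySimple H) :
    TopologicallySimple L := by
  have := h.1
  refine ⟨e.injective.nontrivial, fun N hN hc => ?_⟩
  have hmem : ∀ x, e x ∈ N ↔ x ∈ N.comap e.toMulEquiv.toMonoidHom := fun _ => Iff.rfl
  rcases h.2 (N.comap e.toMulEquiv.toMonoidHom) inferInstance (hc.preimage e.continuous)
    with h' | h'
  · refine Or.inl ((Subgroup.eq_bot_iff_forall _).2 fun y hy => ?_)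
    obtain ⟨x, rfl⟩ := e.surjective y
    rw [hmem, h', Subgroup.mem_bot] at hy
    rw [hy, map_one]
  · refine Or.inr (top_le_iff.1 fun y _ => ?_)
    obtain ⟨x, rfl⟩ := e.surjective y
    rw [hmem, h']
    trivial

/-- The open embedding `f` as an isomorphism of topological groups onto its image. -/
noncomputable def rangeEquivOfIsOpenEmbedding (f : H →* L) (hf : IsOpenEmbedding f) :
    H ≃ₜ* f.range :=
  { MonoidHom.ofInjective hf.injective with
    continuous_toFun := hf.continuous.subtype_mk _
    continuous_invFun := by
      refine hf.isEmbedding.isInducing.continuous_iff.2 ?_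
      have h : f ∘ (MonoidHom.ofInjective hf.injective).symm = Subtype.val := funext fun y =>
        congrArg Subtype.val ((MonoidHom.ofInjective hf.injective).apply_symm_apply y)
      exact h ▸ continuous_subtype_val }

theorem TopologicallySimple.range {f : H →* L} (hf : IsOpenEmbedding f)
    (h : TopologicallySimple H) : TopologicallySimple f.range :=
  h.of_continuousMulEquiv (rangeEquivOfIsOpenEmbedding f hf)

theorem RegionallyExpansive.of_isOpenEmbedding {f : H →* L} (hf : IsOpenEmbedding f)
    (h : RegionallyExpansive H) : RegionallyExpansive L := by
  obtain ⟨O, hO, ⟨K, hK, hKO⟩, W, hWc, hWo, hW⟩ := h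
  have hfO : IsOpenEmbedding (f.comp O.subtype) := hf.comp hO.isOpenEmbedding_subtypeVal
  let e := rangeEquivOfIsOpenEmbedding (f.comp O.subtype) hfO
  refine ⟨(f.comp O.subtype).range, hfO.isOpen_range, ⟨e '' K, hK.image e.continuous, ?_⟩,
    W.map e.toMulEquiv.toMonoidHom, hWc.image e.continuous, e.toHomeomorph.isOpenMap _ hWo, ?_⟩
  · have := MonoidHom.map_closure e.toMulEquiv.toMonoidHom K
    rw [hKO] at this
    exact this.symm.trans (Subgroup.map_top_of_surjective _ e.surjective)
  · refine (Subgroup.eq_bot_iff_forall _).2 fun x hx => ?_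
    obtain ⟨y, rfl⟩ := e.surjective x
    have hy : y ∈ W.normalCore := by
      intro b
      obtain ⟨w, hw, h⟩ := hx (e b)
      have : w = b * y * b⁻¹ := e.injective (h.trans (by simp only [map_mul, map_inv]))
      exact this ▸ hw
    rw [hW, Subgroup.mem_bot] at hy
    rw [hy, map_one]

/-- A topologically simple group is its own monolith, so that membership in the class of robustly
monolithic groups only asks for non-discreteness and regional expansivity. -/
theorem TopologicallySimple.robustlyMonolithic [IsTDLCGroup H] (h : TopologicallySimple H)
    (hd : ¬ DiscreteTopology H) (hr : RegionallyExpansive H) : RobustlyMonolithic H := by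
  have hm := monolith_eq_top_of_topologicallySimple h
  have := h.1
  have e : H ≃ₜ* (⊤ : Subgroup H) :=
    { Subgroup.topEquiv.symm with
      continuous_toFun := continuous_id.subtype_mk _
      continuous_invFun := continuous_subtype_val }
  refine ⟨inferInstance, ?_, ?_, ?_, ?_⟩
  · rw [IsMonolithic, hm]
    exact top_ne_bot
  · rw [hm]
    intro h'
    exact hd (e.toHomeomorph.isEmbedding.discreteTopology)
  · rw [hm]
    exact hr.of_isOpenEmbedding (f := e.toMulEquiv.toMonoidHom) e.toHomeomorph.isOpenEmbedding
  · rw [hm]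
    exact h.of_continuousMulEquiv e

theorem IsTDLCGroup.of_isOpen [IsTDLCGroup L] {S : Subgroup L} (hS : IsOpen (S : Set L)) :
    IsTDLCGroup S where
  toLocallyCompactSpace := hS.locallyCompactSpace

theorem IsTDLCGroup.of_isOpenEmbedding [IsTDLCGroup H] [IsTopologicalGroup L] {f : H →* L}
    (hf : IsOpenEmbedding f) : IsTDLCGroup L := by
  have hr : (f.range : Set L) ∈ 𝓝 1 := hf.isOpen_range.mem_nhds ⟨1, map_one f⟩
  have ht2 : T2Space L := by
    refine IsTopologicalGroup.t2Space_of_one_sep fun x hx => ?_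
    by_cases h : x ∈ f.range
    · obtain ⟨g, rfl⟩ := h
      have hg : g ≠ 1 := by rintro rfl; exact hx (map_one f)
      refine ⟨f '' {g}ᶜ, ?_, ?_⟩
      · rw [← map_one f]
        exact hf.isOpenMap.image_mem_nhds (isOpen_compl_singleton.mem_nhds hg.symm)
      · rintro ⟨g', hg', h⟩
        exact hg' (hf.injective h)
    · exact ⟨_, hr, h⟩
  have hlc : LocallyCompactSpace L := by
    obtain ⟨K, hK, hK1⟩ := exists_compact_mem_nhds (1 : H)
    refine (hK.image hf.continuous).locallyCompactSpace_of_mem_nhds_of_group (x := 1) ?_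
    rw [← map_one f]
    exact hf.isOpenMap.image_mem_nhds hK1
  refine { toT2Space := ht2, toLocallyCompactSpace := hlc, isTotallyDisconnected_univ := ?_ }
  intro t _ ht x hx y hy
  -- After translation the preconnected set contains `1`, so it stays in the clopen range of `f`.
  have ht' : IsPreconnected ((fun z => x⁻¹ * z) '' t) := ht.image _ (by fun_prop)
  have hclopen : IsClopen (f.range : Set L) :=
    ⟨f.range.isClosed_of_isOpen hf.isOpen_range, hf.isOpen_range⟩
  have hsub : (fun z => x⁻¹ * z) '' t ⊆ Set.range f :=
    ht'.subset_isClopen hclopen ⟨1, ⟨x, hx, by simp⟩, f.range.one_mem⟩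
  have hs := (ht'.preimage_of_isOpenMap hf.injective hf.isOpenMap hsub).subsingleton
  obtain ⟨a, ha⟩ := hsub ⟨x, hx, rfl⟩
  obtain ⟨b, hb⟩ := hsub ⟨y, hy, rfl⟩
  have hab : a = b := hs ⟨x, hx, ha.symm⟩ ⟨y, hy, hb.symm⟩
  rw [hab, hb] at ha
  exact (mul_left_cancel ha).symm

/-- A homomorphism of topological groups is continuous and open if its restriction to some open
subgroup is. -/
theorem MonoidHom.continuous_and_isOpenMap_of_subgroup [IsTopologicalGroup H]
    [IsTopologicalGroup L] {f : H →* L} {S : Subgroup H} (hS : IsOpen (S : Set H))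
    (hc : Continuous (f.comp S.subtype)) (ho : IsOpenMap (f.comp S.subtype)) :
    Continuous f ∧ IsOpenMap f := by
  have hm : Filter.map f (𝓝 1) = Filter.map (f.comp S.subtype) (𝓝 1) := by
    have := hS.isOpenEmbedding_subtypeVal.map_nhds_eq (1 : S)
    rw [MonoidHom.coe_comp, ← Filter.map_map]
    exact congrArg _ this.symm
  constructor
  · refine continuous_of_continuousAt_one f ?_
    have h := hc.tendsto 1
    rwa [map_one, Filter.Tendsto, ← hm, ← map_one f] at h
  · refine IsTopologicalGroup.isOpenMap_iff_nhds_one.2 ?_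
    rw [hm]
    simpa using ho.nhds_le 1

end TopologicalGroup

/-! ### The subgroup generated by the topologically simple open subgroups -/

section SimpleSup

variable (L : Type u) [Group L] [TopologicalSpace L]

/-- The subgroup generated by all topologically simple open subgroups. -/
def simpleSup : Subgroup L :=
  sSup {S : Subgroup L | IsOpen (S : Set L) ∧ TopologicallySimple S}

variable {L}

theorem le_simpleSup {S : Subgroup L} (ho : IsOpen (S : Set L)) (hS : TopologicallySimple S) :
    S ≤ simpleSup L :=
  le_sSup ⟨ho, hS⟩

variable [IsTopologicalGroup L]

instance simpleSup_normal : (simpleSup L).Normal := by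
  refine ⟨fun n hn a => ?_⟩
  suffices h : simpleSup L ≤ (simpleSup L).comap (MulAut.conj a).toMonoidHom from h hn
  refine sSup_le fun S hS => ?_
  have hf : IsOpenEmbedding ((MulAut.conj a).toMonoidHom.comp S.subtype) :=
    ((Homeomorph.mulLeft a).trans (Homeomorph.mulRight a⁻¹)).isOpenEmbedding.comp
      hS.1.isOpenEmbedding_subtypeVal
  intro s hs
  exact le_simpleSup hf.isOpen_range (hS.2.range hf) ⟨⟨s, hs⟩, rfl⟩

theorem isOpen_simpleSup {S : Subgroup L} (ho : IsOpen (S : Set L)) (hS : TopologicallySimple S) :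
    IsOpen (simpleSup L : Set L) :=
  Subgroup.isOpen_mono (le_simpleSup ho hS) ho

/-- A closed normal subgroup that does not contain every topologically simple open subgroup meets one
of them trivially, so it lies in the trivial quasi-center. -/
theorem topologicallySimple_simpleSup (hL : quasiCenter L = {1}) {S : Subgroup L}
    (ho : IsOpen (S : Set L)) (hS : TopologicallySimple S) :
    TopologicallySimple (simpleSup L) := by
  have hopen := isOpen_simpleSup ho hS
  have := hS.1
  refine ⟨(Subgroup.inclusion_injective (le_simpleSup ho hS)).nontrivial, fun N hN hc => ?_⟩
  by_cases hall : ∀ R : Subgroup L, IsOpen (R : Set L) → TopologicallySimple R →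
      R.subgroupOf (simpleSup L) ≤ N
  · right
    have hle : simpleSup L ≤ N.map (simpleSup L).subtype :=
      sSup_le fun R hR r hr => ⟨⟨r, le_simpleSup hR.1 hR.2 hr⟩, hall R hR.1 hR.2 hr, rfl⟩
    refine top_le_iff.1 fun x _ => ?_
    obtain ⟨y, hy, hyx⟩ := hle x.2
    rwa [← Subtype.ext hyx]
  · left
    push Not at hall
    obtain ⟨R, hRo, hR, hRN⟩ := hall
    have hRT := le_simpleSup hRo hR
    have hbot : N.comap (Subgroup.inclusion hRT) = ⊥ :=
      (hR.2 _ inferInstance (hc.preimage (continuous_inclusion hRT))).resolve_right fun h =>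
        hRN fun x hx => (h.ge (Subgroup.mem_top ⟨x.1, hx⟩) :)
    have hd : Disjoint N (R.subgroupOf (simpleSup L)) :=
      Subgroup.disjoint_def.2 fun {x} hxN hxR => by
        have : (⟨x.1, hxR⟩ : R) ∈ N.comap (Subgroup.inclusion hRT) := hxN
        rw [hbot, Subgroup.mem_bot] at this
        exact Subtype.ext (congrArg (fun y : R => (y : L)) this)
    have hq : quasiCenter (simpleSup L) = {1} :=
      quasiCenter_eq_of_isOpenEmbedding (simpleSup L).subtype hopen.isOpenEmbedding_subtypeVal hL
    refine (Subgroup.eq_bot_iff_forall _).2 fun x hx => ?_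
    have := subset_quasiCenter_of_disjoint hN (hRo.preimage continuous_subtype_val) hd hx
    rwa [hq] at this

theorem monolith_eq_simpleSup (hL : quasiCenter L = {1}) {S : Subgroup L}
    (ho : IsOpen (S : Set L)) (hS : TopologicallySimple S) : monolith L = simpleSup L :=
  monolith_eq_of_topologicallySimple hL inferInstance (isOpen_simpleSup ho hS)
    (topologicallySimple_simpleSup hL ho hS)

end SimpleSup

/-! ### The homomorphism to the group of germs induced by a local isomorphism -/

namespace LocalIso

variable {G : Type u} {H : Type v} {K : Type w} [Group G] [TopologicalSpace G]
  [Group H] [TopologicalSpace H] [Group K] [TopologicalSpace K]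

/-- The graph of a local isomorphism: `g` lies in the domain of `φ` and is mapped to `h`. Identities
between composites and inverses are checked on graphs, which avoids tracking domains. -/
def Rel (φ : LocalIso G H) (g : G) (h : H) : Prop :=
  ∃ hg : g ∈ φ.source, φ.toHom ⟨g, hg⟩ = h

theorem rel_comp {ψ : LocalIso H K} {φ : LocalIso G H} {g : G} {k : K} :
    (ψ.comp φ).Rel g k ↔ ∃ h, φ.Rel g h ∧ ψ.Rel h k := by
  constructor
  · rintro ⟨⟨h1, h2⟩, rfl⟩
    exact ⟨_, ⟨h1, rfl⟩, h2, rfl⟩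
  · rintro ⟨_, ⟨h1, rfl⟩, h2, rfl⟩
    exact ⟨⟨h1, h2⟩, rfl⟩

theorem rel_inv {φ : LocalIso G H} {g : G} {h : H} : φ.inv.Rel h g ↔ φ.Rel g h := by
  constructor
  · rintro ⟨⟨x, rfl⟩, rfl⟩
    exact ⟨φ.inv_toHom x ⟨x, rfl⟩ ▸ x.2, congrArg φ.toHom (Subtype.ext (φ.inv_toHom x ⟨x, rfl⟩))⟩
  · rintro ⟨hg, rfl⟩
    exact ⟨⟨_, rfl⟩, inv_toHom φ ⟨g, hg⟩ _⟩

theorem rel_conj [IsTopologicalGroup G] {a g h : G} : (conj a).Rel g h ↔ a * g * a⁻¹ = h :=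
  ⟨fun ⟨_, h⟩ => h, fun h => ⟨trivial, h⟩⟩

theorem Rel.unique {φ : LocalIso G H} {g : G} {h h' : H} : φ.Rel g h → φ.Rel g h' → h = h' := by
  rintro ⟨_, rfl⟩ ⟨_, rfl⟩
  rfl

theorem Rel.injective {φ : LocalIso G H} {g g' : G} {h : H} : φ.Rel g h → φ.Rel g' h → g = g' :=
  fun h1 h2 => (rel_inv.2 h1).unique (rel_inv.2 h2)

theorem Rel.mul {φ : LocalIso G H} {g g' : G} {h h' : H} :
    φ.Rel g h → φ.Rel g' h' → φ.Rel (g * g') (h * h') := by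
  rintro ⟨h1, rfl⟩ ⟨h2, rfl⟩
  exact ⟨mul_mem h1 h2, map_mul φ.toHom ⟨g, h1⟩ ⟨g', h2⟩⟩

theorem Rel.inv {φ : LocalIso G H} {g : G} {h : H} : φ.Rel g h → φ.Rel g⁻¹ h⁻¹ := by
  rintro ⟨h1, rfl⟩
  exact ⟨inv_mem h1, map_inv φ.toHom ⟨g, h1⟩⟩

theorem equivalent_of_rel {φ ψ : LocalIso G H}
    (h : ∀ g x y, φ.Rel g x → ψ.Rel g y → x = y) : Equivalent φ ψ :=
  ⟨φ.source ⊓ ψ.source, φ.isOpen_source.inter ψ.isOpen_source, inf_le_left, inf_le_right,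
    fun g hg => h g _ _ ⟨hg.1, rfl⟩ ⟨hg.2, rfl⟩⟩

/-- An open embedding, as a local isomorphism defined everywhere. -/
def ofIsOpenEmbedding (f : G →* H) (hf : IsOpenEmbedding f) : LocalIso G H where
  source := ⊤
  isOpen_source := isOpen_univ
  toHom := f.comp (⊤ : Subgroup G).subtype
  isOpenEmbedding := hf.comp isOpen_univ.isOpenEmbedding_subtypeVal

theorem rel_ofIsOpenEmbedding {f : G →* H} {hf : IsOpenEmbedding f} {g : G} {h : H} :
    (ofIsOpenEmbedding f hf).Rel g h ↔ f g = h :=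
  ⟨fun ⟨_, h⟩ => h, fun h => ⟨trivial, h⟩⟩

variable [IsTopologicalGroup G] [IsTopologicalGroup H]

/-- The homomorphism `h ↦ [φ ∘ conj h ∘ φ⁻¹]` to the group of germs of `G` induced by a local
isomorphism `φ` from `H` to `G`. -/
noncomputable def germHom (φ : LocalIso H G) : H →* GermGroup G :=
  MonoidHom.mk' (fun h => GermGroup.mk (φ.comp ((conj h).comp φ.inv))) (by
    intro a b
    rw [GermGroup.mk_mul_mk, GermGroup.mk_eq_mk]
    refine equivalent_of_rel fun g x y hx hy => ?_
    simp only [rel_comp, rel_inv, rel_conj] at hx hy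
    obtain ⟨_, ⟨p, hp, rfl⟩, hx⟩ := hx
    obtain ⟨_, ⟨_, ⟨q, hq, rfl⟩, hr⟩, _, ⟨r, hr', rfl⟩, hy⟩ := hy
    obtain rfl := hp.injective hq
    obtain rfl := hr.injective hr'
    have e : a * (b * p * b⁻¹) * a⁻¹ = a * b * p * (a * b)⁻¹ := by group
    rw [e] at hy
    exact hx.unique hy)

/-- On the domain of `φ`, `germHom φ` is `ad ∘ φ`; its topological properties follow. -/
theorem germHom_apply_source (φ : LocalIso H G) (h : φ.source) :
    germHom φ h = GermGroup.ad G (φ.toHom h) := by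
  refine GermGroup.mk_eq_mk.2 (equivalent_of_rel fun g x y hx hy => ?_)
  simp only [rel_comp, rel_inv, rel_conj] at hx hy
  obtain ⟨_, ⟨p, hp, rfl⟩, hx⟩ := hx
  have hh : φ.Rel h (φ.toHom h) := ⟨h.2, rfl⟩
  rw [← hy]
  exact hx.unique ((hh.mul hp).mul hh.inv)

theorem continuous_and_isOpenMap_germHom (φ : LocalIso H G) :
    Continuous (germHom φ) ∧ IsOpenMap (germHom φ) := by
  have h : (germHom φ).comp φ.source.subtype = (GermGroup.ad G).comp φ.toHom :=
    MonoidHom.ext (germHom_apply_source φ)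
  refine MonoidHom.continuous_and_isOpenMap_of_subgroup φ.isOpen_source ?_ ?_
  · rw [h]
    exact GermGroup.continuous_ad.comp φ.isOpenEmbedding.continuous
  · rw [h]
    exact GermGroup.isOpenMap_ad.comp φ.isOpenEmbedding.isOpenMap

end LocalIso

/-! ### The group of germs of a group with trivial quasi-center -/

namespace GermGroup

variable {G : Type u} [Group G] [TopologicalSpace G] [IsTopologicalGroup G]

theorem isOpenEmbedding_ad (hqz : quasiCenter G = {1}) : IsOpenEmbedding (ad G) := by
  refine .of_continuous_injective_isOpenMap continuous_ad ?_ isOpenMap_ad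
  refine (injective_iff_map_eq_one _).2 fun g hg => ?_
  obtain ⟨W, hW, _, _, h⟩ := mk_eq_mk.1 hg
  have : g ∈ quasiCenter G :=
    mem_quasiCenter_of_mem_nhds (hW.mem_nhds (one_mem W)) fun u hu => by
      have h' : g * u * g⁻¹ = u := h u hu
      exact (mul_inv_eq_iff_eq_mul.1 h').symm
  rwa [hqz] at this

theorem quasiCenter_eq (hqz : quasiCenter G = {1}) : quasiCenter (GermGroup G) = {1} := by
  refine quasiCenter_eq_singleton fun a ha => ?_
  obtain ⟨φ, rfl⟩ := exists_mk a
  -- On the elements `g` such that `ad g` commutes with the germ of `φ`, the map `φ` is the identity.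
  have hopen : IsOpen ((Subgroup.centralizer {mk φ}).comap (ad G) : Set G) :=
    IsOpen.preimage continuous_ad ha
  refine mk_eq_mk.2 ⟨φ.source ⊓ (Subgroup.centralizer {mk φ}).comap (ad G),
    φ.isOpen_source.inter hopen, inf_le_left, fun _ _ => trivial, fun g hg => ?_⟩
  apply (isOpenEmbedding_ad hqz).injective
  have h1 := mk_mul_ad_mul_inv φ ⟨g, hg.1⟩
  have h2 : ad G g * mk φ = mk φ * ad G g := Subgroup.mem_centralizer_singleton_iff.1 hg.2
  rw [← h1, ← h2, mul_inv_cancel_right]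
  rfl

/-- An open embedding of an open subgroup of the group of germs into the group of germs is
conjugation by the germ that it induces on `G`. -/
theorem exists_eq_conj (hqz : quasiCenter G = {1}) {S : Subgroup (GermGroup G)}
    (hS : IsOpen (S : Set (GermGroup G))) {f : S →* GermGroup G} (hf : IsOpenEmbedding f) :
    ∃ a : GermGroup G, ∀ s : S, f s = a * s * a⁻¹ := by
  let α : LocalIso G (GermGroup G) := .ofIsOpenEmbedding (ad G) (isOpenEmbedding_ad hqz)
  let φ : LocalIso G G := α.inv.comp (LocalIso.comp ⟨S, hS, f, hf⟩ α)
  have hφ : ∀ g : φ.source, ∃ hg : ad G g ∈ S, f ⟨ad G g, hg⟩ = ad G (φ.toHom g) := by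
    intro g
    have h : φ.Rel g (φ.toHom g) := ⟨g.2, rfl⟩
    simp only [φ, α, LocalIso.rel_comp, LocalIso.rel_inv, LocalIso.rel_ofIsOpenEmbedding] at h
    obtain ⟨_, ⟨_, rfl, hg, h1⟩, h2⟩ := h
    exact ⟨hg, h1.trans h2.symm⟩
  refine ⟨mk φ, fun s => DFunLike.congr_fun (MonoidHom.eq_of_eventuallyEq_one
    (f' := (MulAut.conj (mk φ)).toMonoidHom.comp S.subtype)
    (quasiCenter_eq hqz) hf.isOpenMap ?_) s⟩
  have hopen : IsOpen (((↑) : S → GermGroup G) ⁻¹' (ad G '' φ.source)) :=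
    (isOpenMap_ad _ φ.isOpen_source).preimage continuous_subtype_val
  filter_upwards [hopen.mem_nhds ⟨1, one_mem _, map_one _⟩]
  rintro ⟨_, hu⟩ ⟨g, hg, rfl⟩
  obtain ⟨_, h⟩ := hφ ⟨g, hg⟩
  exact h.trans (mk_mul_ad_mul_inv φ ⟨g, hg⟩).symm

theorem range_eq_of_isOpenEmbedding (hqz : quasiCenter G = {1}) {S : Subgroup (GermGroup G)}
    (hn : S.Normal) (hS : IsOpen (S : Set (GermGroup G))) {f : S →* GermGroup G}
    (hf : IsOpenEmbedding f) : f.range = S := by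
  obtain ⟨a, ha⟩ := exists_eq_conj hqz hS hf
  ext x
  constructor
  · rintro ⟨s, rfl⟩
    rw [ha]
    exact hn.conj_mem s s.2 a
  · intro hx
    refine ⟨⟨a⁻¹ * x * a, by simpa using hn.conj_mem x hx a⁻¹⟩, ?_⟩
    rw [ha]
    group

/-- If a normal open subgroup `S` of the group of germs embeds openly in a group `K`, then every
open embedding of `K` in the group of germs with image in `S` is an isomorphism onto `S`. -/
theorem nonempty_continuousMulEquiv (hqz : quasiCenter G = {1}) {S : Subgroup (GermGroup G)}
    (hn : S.Normal) (hS : IsOpen (S : Set (GermGroup G))) {K : Type u} [Group K]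
    [TopologicalSpace K] {θ : K →* GermGroup G} (hθ : IsOpenEmbedding θ) (hle : θ.range ≤ S)
    {j : S →* K} (hj : IsOpenEmbedding j) : Nonempty (K ≃ₜ* S) := by
  have h := range_eq_of_isOpenEmbedding hqz hn hS (f := θ.comp j) (hθ.comp hj)
  have hr : θ.range = S := by
    refine le_antisymm hle (h.symm.le.trans ?_)
    rintro _ ⟨s, rfl⟩
    exact ⟨j s, rfl⟩
  subst hr
  exact ⟨rangeEquivOfIsOpenEmbedding θ hθ⟩

theorem isOpenEmbedding_germHom [T1Space (GermGroup G)] (hd : ¬ DiscreteTopology (GermGroup G))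
    {H : Type u} [Group H] [TopologicalSpace H] [IsTopologicalGroup H]
    (hH : IsOpen (monolith H : Set H)) (φ : LocalIso H G) : IsOpenEmbedding φ.germHom :=
  .of_continuous_injective_isOpenMap φ.continuous_and_isOpenMap_germHom.1
    (injective_of_isOpen_monolith hd hH φ.continuous_and_isOpenMap_germHom.1
      φ.continuous_and_isOpenMap_germHom.2) φ.continuous_and_isOpenMap_germHom.2

end GermGroup

theorem TopologicallySimple.isOpen_monolith {H : Type u} [Group H] [TopologicalSpace H]
    (h : TopologicallySimple H) : IsOpen (monolith H : Set H) := by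
  rw [monolith_eq_top_of_topologicallySimple h]
  exact isOpen_univ

/-- A discrete group is its own quasi-center. -/
theorem not_discreteTopology_of_quasiCenter_eq {G : Type u} [Group G] [TopologicalSpace G]
    [Nontrivial G] (hqz : quasiCenter G = {1}) : ¬ DiscreteTopology G := by
  intro h
  obtain ⟨g, hg⟩ := exists_ne (1 : G)
  have : g ∈ quasiCenter G := isOpen_discrete _
  rw [hqz] at this
  exact hg this

/-! ### Existence and uniqueness of the universal groups -/

theorem LocallyIsomorphic.of_isOpenEmbedding {G : Type u} {H : Type v} [Group G]
    [TopologicalSpace G] [Group H] [TopologicalSpace H] {f : G →* H} (hf : IsOpenEmbedding f) :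
    LocallyIsomorphic H G :=
  ⟨(LocalIso.ofIsOpenEmbedding f hf).inv⟩

theorem IsLargestSimple.robustlyMonolithic {G T : Type u} [Group G] [TopologicalSpace G] [Group T]
    [TopologicalSpace T] (hT : IsLargestSimple G T) (hr : RegionallyExpansive G) :
    RobustlyMonolithic T := by
  have := hT.tdlc
  have := hT.simple.1
  obtain ⟨f, hf⟩ := hT.exists_embedding
  exact hT.simple.robustlyMonolithic (not_discreteTopology_of_quasiCenter_eq hT.quasiCenter_eq)
    (hr.of_isOpenEmbedding hf)

section Universal

variable {G : Type u} [Group G] [TopologicalSpace G] [IsTDLCGroup G]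

theorem monolith_germGroup_eq (hsimple : TopologicallySimple G) (hqz : quasiCenter G = {1}) :
    monolith (GermGroup G) = simpleSup (GermGroup G) :=
  monolith_eq_simpleSup (GermGroup.quasiCenter_eq hqz) (GermGroup.isOpenEmbedding_ad hqz).isOpen_range
    (hsimple.range (GermGroup.isOpenEmbedding_ad hqz))

theorem isOpen_monolith_germGroup (hsimple : TopologicallySimple G) (hqz : quasiCenter G = {1}) :
    IsOpen (monolith (GermGroup G) : Set (GermGroup G)) := by
  rw [monolith_germGroup_eq hsimple hqz]
  exact isOpen_simpleSup (GermGroup.isOpenEmbedding_ad hqz).isOpen_range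
    (hsimple.range (GermGroup.isOpenEmbedding_ad hqz))

theorem topologicallySimple_monolith_germGroup (hsimple : TopologicallySimple G)
    (hqz : quasiCenter G = {1}) : TopologicallySimple (monolith (GermGroup G)) := by
  rw [monolith_germGroup_eq hsimple hqz]
  exact topologicallySimple_simpleSup (GermGroup.quasiCenter_eq hqz)
    (GermGroup.isOpenEmbedding_ad hqz).isOpen_range
    (hsimple.range (GermGroup.isOpenEmbedding_ad hqz))

theorem monolith_germGroup_normal (hsimple : TopologicallySimple G) (hqz : quasiCenter G = {1}) :
    (monolith (GermGroup G)).Normal := by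
  rw [monolith_germGroup_eq hsimple hqz]
  infer_instance

theorem range_le_monolith_germGroup (hsimple : TopologicallySimple G) (hqz : quasiCenter G = {1})
    {H : Type u} [Group H] [TopologicalSpace H] (hH : TopologicallySimple H)
    {θ : H →* GermGroup G} (hθ : IsOpenEmbedding θ) : θ.range ≤ monolith (GermGroup G) := by
  rw [monolith_germGroup_eq hsimple hqz]
  exact le_simpleSup hθ.isOpen_range (hH.range hθ)

theorem isOpenEmbedding_codRestrict {H : Type u} {L : Type v} [Group H] [TopologicalSpace H]
    [Group L] [TopologicalSpace L] {θ : H →* L} (hθ : IsOpenEmbedding θ) {M : Subgroup L}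
    (hM : IsOpen (M : Set L)) (h : ∀ x, θ x ∈ M) : IsOpenEmbedding (θ.codRestrict M h) :=
  .of_comp (g := Subtype.val) _ hM.isOpenEmbedding_subtypeVal hθ

theorem not_discreteTopology_germGroup (hsimple : TopologicallySimple G)
    (hqz : quasiCenter G = {1}) : ¬ DiscreteTopology (GermGroup G) := by
  have := hsimple.1
  intro h
  exact not_discreteTopology_of_quasiCenter_eq hqz
    (GermGroup.isOpenEmbedding_ad hqz).isEmbedding.discreteTopology

theorem isLargestSimple_monolith_germGroup (hsimple : TopologicallySimple G)
    (hqz : quasiCenter G = {1}) : IsLargestSimple G (monolith (GermGroup G)) := by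
  have had := GermGroup.isOpenEmbedding_ad hqz
  have : IsTDLCGroup (GermGroup G) := .of_isOpenEmbedding had
  have hM := isOpen_monolith_germGroup hsimple hqz
  refine ⟨.of_isOpen hM, topologicallySimple_monolith_germGroup hsimple hqz,
    quasiCenter_eq_of_isOpenEmbedding (monolith (GermGroup G)).subtype
      hM.isOpenEmbedding_subtypeVal (GermGroup.quasiCenter_eq hqz),
    ⟨_, isOpenEmbedding_codRestrict had hM fun x =>
      range_le_monolith_germGroup hsimple hqz hsimple had ⟨x, rfl⟩⟩, ?_⟩
  intro H _ _ _ hH ⟨φ⟩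
  have hφ := GermGroup.isOpenEmbedding_germHom (not_discreteTopology_germGroup hsimple hqz)
    hH.isOpen_monolith φ
  exact ⟨_, isOpenEmbedding_codRestrict hφ hM fun x =>
    range_le_monolith_germGroup hsimple hqz hH hφ ⟨x, rfl⟩⟩

theorem IsLargestSimple.nonempty_continuousMulEquiv (hsimple : TopologicallySimple G)
    (hqz : quasiCenter G = {1}) {T : Type u} [Group T] [TopologicalSpace T]
    (hT : IsLargestSimple G T) : Nonempty (T ≃ₜ* monolith (GermGroup G)) := by
  have := hT.tdlc
  have : IsTDLCGroup (GermGroup G) := .of_isOpenEmbedding (GermGroup.isOpenEmbedding_ad hqz)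
  have hL := isLargestSimple_monolith_germGroup hsimple hqz
  have := hL.tdlc
  obtain ⟨f, hf⟩ := hT.exists_embedding
  obtain ⟨φ⟩ := LocallyIsomorphic.of_isOpenEmbedding hf
  obtain ⟨f', hf'⟩ := hL.exists_embedding
  obtain ⟨j, hj⟩ := hT.universal _ hL.simple (.of_isOpenEmbedding hf')
  have hφ := GermGroup.isOpenEmbedding_germHom (not_discreteTopology_germGroup hsimple hqz)
    hT.simple.isOpen_monolith φ
  exact GermGroup.nonempty_continuousMulEquiv hqz (monolith_germGroup_normal hsimple hqz)
    (isOpen_monolith_germGroup hsimple hqz) hφ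
    (range_le_monolith_germGroup hsimple hqz hT.simple hφ) hj

theorem robustlyMonolithic_germGroup (hsimple : TopologicallySimple G)
    (hqz : quasiCenter G = {1}) (hr : RegionallyExpansive G) :
    RobustlyMonolithic (GermGroup G) := by
  have hT := isLargestSimple_monolith_germGroup hsimple hqz
  have := hT.simple.1
  obtain ⟨f, hf⟩ := hT.exists_embedding
  exact ⟨.of_isOpenEmbedding (GermGroup.isOpenEmbedding_ad hqz),
    (Subgroup.nontrivial_iff_ne_bot _).1 hT.simple.1,
    not_discreteTopology_of_quasiCenter_eq hT.quasiCenter_eq, hr.of_isOpenEmbedding hf, hT.simple⟩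

theorem isUniversalLocalGroup_germGroup (hsimple : TopologicallySimple G)
    (hqz : quasiCenter G = {1}) (hr : RegionallyExpansive G) :
    IsUniversalLocalGroup G (GermGroup G) := by
  have hT := isLargestSimple_monolith_germGroup hsimple hqz
  have hL := robustlyMonolithic_germGroup hsimple hqz hr
  have := hL.tdlc
  refine ⟨hL.tdlc, hL.monolithic, isOpen_monolith_germGroup hsimple hqz, hT.exists_embedding,
    ?_, hT.robustlyMonolithic hr, hL⟩
  intro H _ _ _ ⟨φ⟩
  refine ⟨φ.germHom, φ.continuous_and_isOpenMap_germHom.1, φ.continuous_and_isOpenMap_germHom.2,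
    fun hH => ?_⟩
  exact range_le_monolith_germGroup hsimple hqz hH
    (GermGroup.isOpenEmbedding_germHom (not_discreteTopology_germGroup hsimple hqz)
      hH.isOpen_monolith φ)

/-- The homomorphisms `L → ℒ(G)` and `ℒ(G) → L` given by the two universal properties are open
embeddings, and their composite on `ℒ(G)` is an inner automorphism, so the first one is onto. -/
theorem IsUniversalLocalGroup.nonempty_continuousMulEquiv (hsimple : TopologicallySimple G)
    (hqz : quasiCenter G = {1}) {L : Type u} [Group L] [TopologicalSpace L]
    (hL : IsUniversalLocalGroup G L) : Nonempty (L ≃ₜ* GermGroup G) := by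
  have had := GermGroup.isOpenEmbedding_ad hqz
  have := hL.tdlc
  have : IsTDLCGroup (GermGroup G) := .of_isOpenEmbedding had
  obtain ⟨f, hf⟩ := hL.exists_embedding
  obtain ⟨φ⟩ := LocallyIsomorphic.of_isOpenEmbedding (f := (monolith L).subtype.comp f)
    (hL.isOpen_monolith.isOpenEmbedding_subtypeVal.comp hf)
  have hφ := GermGroup.isOpenEmbedding_germHom (not_discreteTopology_germGroup hsimple hqz)
    hL.isOpen_monolith φ
  obtain ⟨θ, hθc, hθo, -⟩ := hL.universal (GermGroup G) (.of_isOpenEmbedding had)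
  have hLd : ¬ DiscreteTopology L := fun _ => hL.robustlyMonolithic.nondiscrete inferInstance
  have hθ : IsOpenEmbedding θ := .of_continuous_injective_isOpenMap hθc
    (injective_of_isOpen_monolith hLd (isOpen_monolith_germGroup hsimple hqz) hθc hθo) hθo
  have htop : IsOpenEmbedding (⊤ : Subgroup (GermGroup G)).subtype :=
    isOpen_univ.isOpenEmbedding_subtypeVal
  have hsurj := GermGroup.range_eq_of_isOpenEmbedding hqz inferInstance isOpen_univ
    (f := φ.germHom.comp (θ.comp (⊤ : Subgroup (GermGroup G)).subtype))
    (hφ.comp (hθ.comp htop))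
  have hφs : Function.Surjective φ.germHom := fun x => by
    obtain ⟨y, hy⟩ := hsurj.ge (Subgroup.mem_top x)
    exact ⟨_, hy⟩
  exact ⟨{ MulEquiv.ofBijective φ.germHom ⟨hφ.injective, hφs⟩ with
    continuous_toFun := hφ.continuous
    continuous_invFun := (hφ.toHomeomorphOfSurjective hφs).symm.continuous }⟩

end Universal

theorem mainTheorem4 (G : Type u) [Group G] [TopologicalSpace G] [IsTDLCGroup G]
    (hsimple : TopologicallySimple G) (hqz : quasiCenter G = {1}) :
    ∃ (T : Type u) (_ : Group T) (_ : TopologicalSpace T),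
      IsLargestSimple G T ∧
      (∀ (T' : Type u) [Group T'] [TopologicalSpace T'],
        IsLargestSimple G T' → Nonempty (T' ≃ₜ* T)) ∧
      (RegionallyExpansive G →
        RobustlyMonolithic G ∧ RobustlyMonolithic T ∧ RobustlyMonolithic (GermGroup G) ∧
        IsUniversalLocalGroup G (GermGroup G) ∧
        (∀ (L : Type u) [Group L] [TopologicalSpace L],
          IsUniversalLocalGroup G L → Nonempty (L ≃ₜ* GermGroup G)) ∧
        Nonempty (T ≃ₜ* monolith (GermGroup G))) := by
  have := hsimple.1
  have hT := isLargestSimple_monolith_germGroup hsimple hqz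
  refine ⟨monolith (GermGroup G), inferInstance, inferInstance, hT,
    fun T' _ _ hT' => hT'.nonempty_continuousMulEquiv hsimple hqz, fun hr => ?_⟩
  exact ⟨hsimple.robustlyMonolithic (not_discreteTopology_of_quasiCenter_eq hqz) hr,
    hT.robustlyMonolithic hr, robustlyMonolithic_germGroup hsimple hqz hr,
    isUniversalLocalGroup_germGroup hsimple hqz hr,
    fun L _ _ hL => hL.nonempty_continuousMulEquiv hsimple hqz, ⟨.refl _⟩⟩
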